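/- Let $\mathcal H$ be a finite-dimensional complex Hilbert space, and let $\mathcal B(\mathcal H)$ be the algebra of (bounded) linear operators on $\mathcal H$ with the operator norm. Let $$\mathrm{nil}_2=\{M\in\mathcal B(\mathcal H): M^2=0\},\qquad \mathfrak c(\mathrm{nil}_2)=\{MN-NM : M,N\in \mathrm{nil}_2\}.$$ An operator $T\in\mathcal B(\mathcal H)$ is called balanced if (a) $\sigma(T)=\sigma(-T)$; (b) whenever $\Omega_1,\Omega_2\subseteq\mathbb C$ are disjoint open sets with $\sigma(T)\subseteq\Omega_1\cup\Omega_2$, the ranges of the Riesz idempotents of $T$ corresponding to $\sigma(T)\cap\Omega_1$ and to $\sigma(T)\cap(-\Omega_1)$ have the same dimension; (c) for every $\alpha\in\mathbb C$, $T-\alpha I$ is semi-Fredholm if and only if $T+\alpha I$ is, and in that case $\operatorname{ind}(T-\alpha I)=\operatorname{ind}(T+\alpha I)$, where $\operatorname{ind}A=\dim\ker A-\dim\ker A^*$. (An operator is semi-Fredholm if it is left- or right-invertible modulo the compact operators.) Let $\mathrm{Bal}(\mathcal H)$ be the set of balanced operators on $\mathcal H$. Then the norm closure of $\mathfrak c(\mathrm{nil}_2)$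 in $\mathcal B(\mathcal H)$ is $$\overline{\mathfrak c(\mathrm{nil}_2)}=\mathrm{Bal}(\mathcal H)=\{T\in\mathcal B(\mathcal H): \text{for every } \alpha\in\sigma(T),\ -\alpha\in\sigma(T) \text{ and } \mu_T(\alpha)=\mu_T(-\alpha)\},$$ where $\mu_T(\alpha)$ is the algebraic multiplicity of the eigenvalue $\alpha$ of $T$. -/

import Mathlib

open scoped Pointwise

noncomputable section

/-- `𝔠(Ω) = {[A, B] : A, B ∈ Ω}`, where `[A, B] = AB - BA`. -/
def operatorCommutators {R : Type*} [Ring R] (Ω : Set R) : Set R :=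
  {T | ∃ A ∈ Ω, ∃ B ∈ Ω, T = A * B - B * A}

variable (H : Type*) [NormedAddCommGroup H] [InnerProductSpace ℂ H]

/-- `nil₂`, the set of bounded operators on `H` of square zero. -/
def squareZeroOps : Set (H →L[ℂ] H) :=
  {M | M ^ 2 = 0}

variable {H}

/-- `E` is the Riesz idempotent `E(Ω; T) = (2πi)⁻¹ ∮_Γ (z - T)⁻¹ dz`. The spectrum of an operator on
a finite-dimensional space is finite, so the contour `Γ` can be taken to be a finite union of
positively oriented circles: the boundaries of the discs `closedBall p.1 p.2`, `p ∈ s`, which lie in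
`Ω`, are pairwise disjoint, and contain `σ(T) ∩ Ω` in the union of their interiors. The value of
the integral does not depend on the choice of the discs. -/
def IsRieszIdempotent [FiniteDimensional ℂ H] (Ω : Set ℂ) (T E : H →L[ℂ] H) : Prop :=
  ∃ s : Finset (ℂ × ℝ),
    (∀ p ∈ s, 0 < p.2 ∧ Metric.closedBall p.1 p.2 ⊆ Ω) ∧
    (∀ p ∈ s, ∀ q ∈ s, p ≠ q →
      Disjoint (Metric.closedBall p.1 p.2) (Metric.closedBall q.1 q.2)) ∧
    (spectrum ℂ T ∩ Ω ⊆ ⋃ p ∈ s, Metric.ball p.1 p.2) ∧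
    E = ∑ p ∈ s, (2 * (Real.pi : ℂ) * Complex.I)⁻¹ • ∮ z in C(p.1, p.2), resolvent T z

/-- `A` is semi-Fredholm: its image in the quotient of the bounded operators by the compact
operators is left-invertible or right-invertible. -/
def IsSemiFredholm (A : H →L[ℂ] H) : Prop :=
  (∃ S : H →L[ℂ] H, IsCompactOperator (S * A - 1 : H →L[ℂ] H)) ∨
    (∃ S : H →L[ℂ] H, IsCompactOperator (A * S - 1 : H →L[ℂ] H))

/-- `ind A = nul A - nul A*`. On a finite-dimensional space both nullities are finite. -/
def fredholmIndex [FiniteDimensional ℂ H] [CompleteSpace H] (A : H →L[ℂ] H) : ℤ :=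
  (Module.finrank ℂ (A : H →ₗ[ℂ] H).ker : ℤ) -
    (Module.finrank ℂ (ContinuousLinearMap.adjoint A : H →ₗ[ℂ] H).ker : ℤ)

/-- Balanced operators on a finite-dimensional Hilbert space. In `dim_eq`, the subspaces compared are
the ranges of the Riesz idempotents `E(Ω₁; T)` and `E(-Ω₁; T)`. -/
structure IsBalanced [FiniteDimensional ℂ H] [CompleteSpace H] (T : H →L[ℂ] H) : Prop where
  spectrum_eq : spectrum ℂ T = spectrum ℂ (-T)
  dim_eq : ∀ Ω₁ Ω₂ : Set ℂ, IsOpen Ω₁ → IsOpen Ω₂ → Disjoint Ω₁ Ω₂ →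
    spectrum ℂ T ⊆ Ω₁ ∪ Ω₂ →
    ∃ E F : H →L[ℂ] H, IsRieszIdempotent Ω₁ T E ∧ IsRieszIdempotent (-Ω₁) T F ∧
      Module.finrank ℂ (E : H →ₗ[ℂ] H).range = Module.finrank ℂ (F : H →ₗ[ℂ] H).range
  index_eq : ∀ α : ℂ,
    (IsSemiFredholm (T - α • (1 : H →L[ℂ] H)) ↔ IsSemiFredholm (T + α • (1 : H →L[ℂ] H))) ∧
    (IsSemiFredholm (T - α • (1 : H →L[ℂ] H)) →
      fredholmIndex (T - α • (1 : H →L[ℂ] H)) = fredholmIndex (T + α • (1 : H →L[ℂ] H)))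

/-- `μ(α)`, the algebraic multiplicity of `α` as an eigenvalue of `T`: its multiplicity as a root of
the characteristic polynomial. -/
def algMultiplicity [FiniteDimensional ℂ H] (T : H →L[ℂ] H) (α : ℂ) : ℕ :=
  (LinearMap.charpoly (T : H →ₗ[ℂ] H)).rootMultiplicity α

end

/-! Everything reduces to one condition: `T` and `-T` have the same characteristic polynomial, i.e.
multiplicities are symmetric under `α ↦ -α`. If `M² = N² = 0`, then `MN - NM = (M - N)(M + N)` and
its negative is `(M + N)(M - N)`. Since `AB` and `BA` share a characteristic polynomial, commutators
satisfy the condition, which is closed by continuity of `det (z - T)`. Conversely, symmetric roots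
split into pairs `l, -l` and at most one extra `0`. Moving `T` along a line
(`Module.End.exists_charpoly_add_smul`) makes the roots distinct while keeping the pairing. The
moved operator is diagonalizable, and each block `diag(l, -l)` is a commutator of square-zero
matrices. As for balancedness, the index condition is automatic in finite dimension. By the residue
calculus, the rank of a Riesz idempotent is the sum of the multiplicities in `Ω`
(`IsRieszIdempotent.finrank_range`). Small discs then recover the individual multiplicities. -/

/-! ### Riesz idempotents and generalized eigenspaces -/

section Riesz

open Metric

variable {H : Type*} [NormedAddCommGroup H] [InnerProductSpace ℂ H]

/-- The truncated Neumann series of `(c - A)⁻¹`; the sum telescopes. -/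
lemma sub_apply_sum_inv_pow (A : H →ₗ[ℂ] H) {c : ℂ} (hc : c ≠ 0) (v : H) (n : ℕ) :
    c • (∑ k ∈ Finset.range n, (c⁻¹) ^ (k + 1) • (A ^ k) v) -
      A (∑ k ∈ Finset.range n, (c⁻¹) ^ (k + 1) • (A ^ k) v) = v - (c⁻¹) ^ n • (A ^ n) v := by
  induction n with
  | zero => simp
  | succ n ih =>
    have h1 : c • (c⁻¹) ^ (n + 1) • (A ^ n) v = (c⁻¹) ^ n • (A ^ n) v := by
      rw [smul_smul, pow_succ', mul_inv_cancel_left₀ hc]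
    have h2 : A ((c⁻¹) ^ (n + 1) • (A ^ n) v) = (c⁻¹) ^ (n + 1) • (A ^ (n + 1)) v := by
      rw [map_smul, pow_succ' A]; rfl
    rw [Finset.sum_range_succ, smul_add, map_add, h1, h2, add_sub_add_comm, ih]
    abel

/-- The Neumann series terminates on a generalized eigenvector, leaving finitely many powers of `(z
- α)⁻¹` to integrate. -/
lemma resolvent_apply_of_pow_apply_eq_zero (T : H →L[ℂ] H) {α z : ℂ} (hz : z ∈ resolventSet ℂ T)
    (hzα : z ≠ α) {v : H} {n : ℕ} (hv : (((T : H →ₗ[ℂ] H) - α • 1) ^ n) v = 0) :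
    resolvent T z v =
      ∑ k ∈ Finset.range n, ((z - α)⁻¹) ^ (k + 1) • (((T : H →ₗ[ℂ] H) - α • 1) ^ k) v := by
  set w := ∑ k ∈ Finset.range n, ((z - α)⁻¹) ^ (k + 1) • (((T : H →ₗ[ℂ] H) - α • 1) ^ k) v with hw
  have h := sub_apply_sum_inv_pow ((T : H →ₗ[ℂ] H) - α • 1) (sub_ne_zero.2 hzα) v n
  rw [hv, smul_zero, sub_zero, ← hw] at h
  have h1 : (algebraMap ℂ (H →L[ℂ] H) z - T) w = v := by
    rw [← h]
    simp [Algebra.algebraMap_eq_smul_one, sub_smul]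
  have h2 : resolvent T z * (algebraMap ℂ (H →L[ℂ] H) z - T) = 1 :=
    Ring.inverse_mul_cancel _ hz
  rw [← h1, ← mul_apply_eq_comp, h2, one_apply_eq_self]

lemma circleIntegral_apply {f : ℂ → H →L[ℂ] H} {c : ℂ} {R : ℝ} (hf : CircleIntegrable f c R)
    (v : H) : (∮ z in C(c, R), f z) v = ∮ z in C(c, R), f z v := by
  simp only [circleIntegral]
  rw [ContinuousLinearMap.intervalIntegral_apply hf.out]
  rfl

lemma circleIntegral_sub_inv_pow_of_mem_ball {c α : ℂ} {R : ℝ} (hα : α ∈ ball c R) (k : ℕ) :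
    (∮ z in C(c, R), ((z - α)⁻¹) ^ (k + 1)) = if k = 0 then 2 * (Real.pi : ℂ) * Complex.I else 0 := by
  split_ifs with h
  · subst h
    simpa using circleIntegral.integral_sub_inv_of_mem_ball hα
  · have := circleIntegral.integral_sub_zpow_of_ne (n := -((k : ℤ) + 1)) (by omega) c α R
    rw [← this]
    congr 1
    ext z
    rw [zpow_neg, inv_pow]
    norm_cast

lemma circleIntegral_sub_inv_pow_of_notMem_closedBall {c α : ℂ} {R : ℝ} (hR : 0 < R)
    (hα : α ∉ closedBall c R) (k : ℕ) :
    (∮ z in C(c, R), ((z - α)⁻¹) ^ (k + 1)) = 0 := by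
  apply DiffContOnCl.circleIntegral_eq_zero hR.le
  apply DifferentiableOn.diffContOnCl
  rw [closure_ball c hR.ne']
  intro z hz
  have : z - α ≠ 0 := sub_ne_zero.2 (by rintro rfl; exact hα hz)
  exact (((differentiableAt_id.sub_const α).inv this).pow _).differentiableWithinAt

variable [CompleteSpace H]

lemma circleIntegrable_resolvent {T : H →L[ℂ] H} {c : ℂ} {R : ℝ} (hR : 0 ≤ R)
    (h : ∀ z ∈ sphere c R, z ∉ spectrum ℂ T) : CircleIntegrable (resolvent T) c R := by
  apply ContinuousOn.circleIntegrable hR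
  intro z hz
  have : z ∈ resolventSet ℂ T := by
    by_contra h'
    exact h z hz h'
  exact (spectrum.hasDerivAt_resolvent_const_left this).continuousAt.continuousWithinAt

open scoped Classical in
/-- The normalized integral of the resolvent of `T` over a circle acts as the identity or as zero on
a generalized eigenvector, according to whether the eigenvalue is inside or outside the circle. -/
lemma circleIntegral_resolvent_apply {T : H →L[ℂ] H} {c α : ℂ} {R : ℝ} (hR : 0 < R)
    (h : ∀ z ∈ sphere c R, z ∉ spectrum ℂ T) (hα : α ∈ spectrum ℂ T) {v : H}
    (hv : v ∈ Module.End.maxGenEigenspace (T : H →ₗ[ℂ] H) α) :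
    ((2 * (Real.pi : ℂ) * Complex.I)⁻¹ • ∮ z in C(c, R), resolvent T z) v =
      if α ∈ ball c R then v else 0 := by
  obtain ⟨n, hn⟩ := (Module.End.mem_maxGenEigenspace _ _ _).1 hv
  -- The exponent is raised to `n + 1` so that the term `k = 0`, the only one with a residue, is
  -- present even if `n = 0`.
  have hn' : (((T : H →ₗ[ℂ] H) - α • 1) ^ (n + 1)) v = 0 := by
    rw [pow_succ', Module.End.mul_apply, hn, map_zero]
  have hne : ∀ z ∈ sphere c R, z ≠ α := by
    rintro z hz rfl
    exact h z hz hα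
  have hint : (∮ z in C(c, R), resolvent T z v) =
      ∑ k ∈ Finset.range (n + 1), (∮ z in C(c, R), ((z - α)⁻¹) ^ (k + 1)) •
        (((T : H →ₗ[ℂ] H) - α • 1) ^ k) v := by
    rw [circleIntegral.integral_congr hR.le (g := fun z ↦ ∑ k ∈ Finset.range (n + 1),
      ((z - α)⁻¹) ^ (k + 1) • (((T : H →ₗ[ℂ] H) - α • 1) ^ k) v), circleIntegral.integral_fun_sum]
    · simp only [circleIntegral.integral_smul_const]
    · intro k _
      apply ContinuousOn.circleIntegrable hR.le
      intro z hz
      have : z - α ≠ 0 := sub_ne_zero.2 (hne z hz)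
      exact ((((continuousAt_id.sub continuousAt_const).inv₀ this).pow _).smul
        continuousAt_const).continuousWithinAt
    · intro z hz
      have : z ∈ resolventSet ℂ T := by
        by_contra h'
        exact h z hz h'
      exact resolvent_apply_of_pow_apply_eq_zero T this (hne z hz) hn'
  rw [smul_apply, circleIntegral_apply (circleIntegrable_resolvent hR.le h),
    hint]
  split_ifs with hb
  · simp only [circleIntegral_sub_inv_pow_of_mem_ball hb]
    rw [Finset.sum_eq_single 0]
    · rw [if_pos rfl, pow_zero, Module.End.one_apply, smul_smul,
        inv_mul_cancel₀ Complex.two_pi_I_ne_zero, one_smul]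
    · intro k _ hk
      simp [hk]
    · simp
  · have : α ∉ closedBall c R := by
      rw [← ball_union_sphere]
      rintro (h' | h')
      · exact hb h'
      · exact hne _ h' rfl
    simp only [circleIntegral_sub_inv_pow_of_notMem_closedBall hR this, zero_smul,
      Finset.sum_const_zero, smul_zero]

variable [FiniteDimensional ℂ H]

open scoped Classical in
lemma IsRieszIdempotent.apply_of_mem_maxGenEigenspace {Ω : Set ℂ} {T E : H →L[ℂ] H}
    (hE : IsRieszIdempotent Ω T E) {α : ℂ} (hα : α ∈ spectrum ℂ T) {v : H}
    (hv : v ∈ Module.End.maxGenEigenspace (T : H →ₗ[ℂ] H) α) :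
    E v = if α ∈ Ω then v else 0 := by
  obtain ⟨s, hs, hd, hc, rfl⟩ := hE
  -- A spectral point on one circle would lie in `Ω`, hence inside some open disc: not its own, and
  -- no other by disjointness.
  have hsph : ∀ p ∈ s, ∀ z ∈ sphere p.1 p.2, z ∉ spectrum ℂ T := by
    intro p hp z hz hzT
    have hzΩ := (hs p hp).2 (sphere_subset_closedBall hz)
    obtain ⟨q, hq, hzq⟩ := Set.mem_iUnion₂.1 (hc ⟨hzT, hzΩ⟩)
    by_cases hpq : p = q
    · subst hpq
      exact (ne_of_lt (mem_ball.1 hzq)) (mem_sphere.1 hz)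
    · exact Set.disjoint_left.1 (hd p hp q hq hpq) (sphere_subset_closedBall hz)
        (ball_subset_closedBall hzq)
  rw [sum_apply, Finset.sum_congr rfl fun p hp ↦
    circleIntegral_resolvent_apply (hs p hp).1 (hsph p hp) hα hv]
  split_ifs with hΩ
  · obtain ⟨q, hq, hαq⟩ := Set.mem_iUnion₂.1 (hc ⟨hα, hΩ⟩)
    rw [Finset.sum_eq_single_of_mem q hq, if_pos hαq]
    intro p hp hpq
    exact if_neg fun h ↦ Set.disjoint_left.1 (hd p hp q hq hpq) (ball_subset_closedBall h)
      (ball_subset_closedBall hαq)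
  · exact Finset.sum_eq_zero fun p hp ↦
      if_neg fun h ↦ hΩ ((hs p hp).2 (ball_subset_closedBall h))

lemma finrank_biSup_of_iSupIndep {ι K V : Type*} [Field K] [AddCommGroup V] [Module K V]
    [FiniteDimensional K V] {f : ι → Submodule K V} (hf : iSupIndep f) (s : Finset ι) :
    Module.finrank K (⨆ i ∈ s, f i : Submodule K V) = ∑ i ∈ s, Module.finrank K (f i) := by
  classical
  induction s using Finset.induction_on with
  | empty => simp
  | insert a s ha ih =>
    rw [Finset.iSup_insert, Finset.sum_insert ha, ← ih]
    have hdis : Disjoint (f a) (⨆ i ∈ s, f i) :=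
      (hf a).mono_right (iSup₂_mono' fun i hi ↦ ⟨i, by rintro rfl; exact ha hi, le_rfl⟩)
    rw [← Submodule.finrank_sup_add_finrank_inf_eq, hdis.eq_bot, finrank_bot, add_zero]

lemma finite_spectrum_clm (T : H →L[ℂ] H) : (spectrum ℂ T).Finite := by
  rw [ContinuousLinearMap.spectrum_eq]
  exact Module.End.finite_spectrum _

lemma algMultiplicity_pos_iff {T : H →L[ℂ] H} {α : ℂ} :
    0 < algMultiplicity T α ↔ α ∈ spectrum ℂ T := by
  rw [ContinuousLinearMap.spectrum_eq, Module.End.mem_spectrum_iff_isRoot_charpoly,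
    algMultiplicity, Polynomial.rootMultiplicity_pos (LinearMap.charpoly_monic _).ne_zero]

lemma maxGenEigenspace_eq_bot_of_notMem_spectrum {T : H →L[ℂ] H} {α : ℂ}
    (h : α ∉ spectrum ℂ T) : Module.End.maxGenEigenspace (T : H →ₗ[ℂ] H) α = ⊥ := by
  rw [← Submodule.finrank_eq_zero, LinearMap.finrank_maxGenEigenspace_eq]
  have := mt algMultiplicity_pos_iff.1 h
  rw [algMultiplicity] at this
  omega

/-- The generalized eigenspaces span `H`, and `E` is the identity or zero on each. So its range is
the sum of those with eigenvalue in `Ω`, and independence makes the dimensions add. -/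
lemma IsRieszIdempotent.finrank_range {Ω : Set ℂ} {T E : H →L[ℂ] H}
    (hE : IsRieszIdempotent Ω T E) (s : Finset ℂ) (hs : (s : Set ℂ) = spectrum ℂ T ∩ Ω) :
    Module.finrank ℂ (E : H →ₗ[ℂ] H).range = ∑ α ∈ s, algMultiplicity T α := by
  classical
  have key : (E : H →ₗ[ℂ] H).range =
      ⨆ α ∈ s, Module.End.maxGenEigenspace (T : H →ₗ[ℂ] H) α := by
    apply le_antisymm
    · rw [LinearMap.range_eq_map, ← Module.End.iSup_maxGenEigenspace_eq_top (T : H →ₗ[ℂ] H),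
        Submodule.map_iSup]
      refine iSup_le fun α ↦ ?_
      rintro _ ⟨v, hv, rfl⟩
      by_cases hα : α ∈ spectrum ℂ T
      · rw [ContinuousLinearMap.coe_coe, hE.apply_of_mem_maxGenEigenspace hα hv]
        split_ifs with hΩ
        · have : α ∈ s := by
            rw [← Finset.mem_coe, hs]
            exact ⟨hα, hΩ⟩
          exact Submodule.mem_iSup_of_mem α (Submodule.mem_iSup_of_mem this hv)
        · exact zero_mem _
      · rw [maxGenEigenspace_eq_bot_of_notMem_spectrum hα] at hv
        rw [(Submodule.mem_bot ℂ).1 hv, map_zero]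
        exact zero_mem _
    · refine iSup₂_le fun α hα v hv ↦ ⟨v, ?_⟩
      rw [← Finset.mem_coe, hs] at hα
      rw [ContinuousLinearMap.coe_coe, hE.apply_of_mem_maxGenEigenspace hα.1 hv, if_pos hα.2]
  rw [key, finrank_biSup_of_iSupIndep (Module.End.independent_maxGenEigenspace _)]
  exact Finset.sum_congr rfl fun α _ ↦ LinearMap.finrank_maxGenEigenspace_eq _ _

/-- Around the points of a finite set, closed discs of a sufficiently small common radius lie in a
given open set and are pairwise disjoint. -/
lemma exists_disjoint_closedBalls {s : Set ℂ} (hs : s.Finite) {Ω : Set ℂ} (hΩ : IsOpen Ω)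
    (hsΩ : s ⊆ Ω) : ∃ r > 0, (∀ a ∈ s, closedBall a r ⊆ Ω) ∧
      ∀ a ∈ s, ∀ b ∈ s, a ≠ b → Disjoint (closedBall a r) (closedBall b r) := by
  have h1 : ∀ᶠ r in nhdsWithin (0 : ℝ) (Set.Ioi 0), ∀ a ∈ s, closedBall a r ⊆ Ω := by
    rw [Filter.eventually_all_finite hs]
    intro a ha
    obtain ⟨ε, hε, h⟩ := Metric.isOpen_iff.1 hΩ a (hsΩ ha)
    filter_upwards [Ioo_mem_nhdsGT hε] with r hr
    exact (closedBall_subset_ball hr.2).trans h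
  have h2 : ∀ᶠ r in nhdsWithin (0 : ℝ) (Set.Ioi 0), ∀ a ∈ s, ∀ b ∈ s, a ≠ b →
      Disjoint (closedBall a r) (closedBall b r) := by
    rw [Filter.eventually_all_finite hs]
    intro a ha
    rw [Filter.eventually_all_finite hs]
    intro b hb
    by_cases hab : a = b
    · simp [hab]
    filter_upwards [Ioo_mem_nhdsGT (half_pos (dist_pos.2 hab))] with r hr _
    exact closedBall_disjoint_closedBall (by linarith [hr.2])
  obtain ⟨r, ⟨ha, hb⟩, hr⟩ := ((h1.and h2).and self_mem_nhdsWithin).exists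
  exact ⟨r, hr, ha, hb⟩

lemma exists_isRieszIdempotent (T : H →L[ℂ] H) {Ω : Set ℂ} (hΩ : IsOpen Ω) :
    ∃ E : H →L[ℂ] H, IsRieszIdempotent Ω T E := by
  classical
  have hfin : (spectrum ℂ T ∩ Ω).Finite := (finite_spectrum_clm T).inter_of_left _
  obtain ⟨r, hr, h1, h2⟩ := exists_disjoint_closedBalls hfin hΩ Set.inter_subset_right
  refine ⟨_, hfin.toFinset.image fun a ↦ (a, r), ?_, ?_, ?_, rfl⟩
  · simp only [Finset.mem_image, Set.Finite.mem_toFinset]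
    rintro _ ⟨a, ha, rfl⟩
    exact ⟨hr, h1 a ha⟩
  · simp only [Finset.mem_image, Set.Finite.mem_toFinset]
    rintro _ ⟨a, ha, rfl⟩ _ ⟨b, hb, rfl⟩ hab
    exact h2 a ha b hb fun h ↦ hab (by rw [h])
  · intro a ha
    refine Set.mem_iUnion₂.2 ⟨(a, r), ?_, mem_ball_self hr⟩
    simp only [Finset.mem_image, Set.Finite.mem_toFinset]
    exact ⟨a, ha, rfl⟩

end Riesz

/-! ### Perturbing eigenvalues and diagonal commutators -/

section Density

open Polynomial Module

lemma exists_basis_sum_inl_eq {K V : Type*} [Field K] [AddCommGroup V] [Module K V]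
    [FiniteDimensional K V] {n : ℕ} (hn : finrank K V = n + 1) {v : V} (hv : v ≠ 0) :
    ∃ b : Basis (Unit ⊕ Fin n) K V, b (Sum.inl ()) = v := by
  obtain ⟨W, hW⟩ := Submodule.exists_isCompl (K ∙ v)
  have hWn : finrank K W = n := by
    have := Submodule.finrank_add_eq_of_isCompl hW
    rw [finrank_span_singleton hv] at this
    omega
  let b₁ : Basis Unit K (K ∙ v) :=
    (Basis.singleton Unit K).map (LinearEquiv.toSpanNonzeroSingleton K V v hv)
  refine ⟨(b₁.prod (finBasisOfFinrankEq K W hWn)).map (Submodule.prodEquivOfIsCompl _ _ hW), ?_⟩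
  simp [b₁]

/-- The eigenvalues of a complex matrix can be moved simultaneously and linearly in any prescribed
directions by moving the matrix along a line. -/
lemma Matrix.exists_charpoly_add_smul {n : ℕ} (A : Matrix (Fin n) (Fin n) ℂ) (μ c : Fin n → ℂ)
    (h : A.charpoly = ∏ i, (X - C (μ i))) :
    ∃ D : Matrix (Fin n) (Fin n) ℂ, ∀ t : ℂ,
      (A + t • D).charpoly = ∏ i, (X - C (μ i + t * c i)) := by
  induction n with
  | zero => exact ⟨0, fun t ↦ by simp⟩
  | succ n ih =>
    have hroot : Module.End.HasEigenvalue (Matrix.toLin' A) (μ 0) := by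
      rw [Module.End.hasEigenvalue_iff_isRoot_charpoly, Matrix.charpoly_toLin', h,
        Fin.prod_univ_succ]
      simp
    obtain ⟨v, hv⟩ := hroot.exists_hasEigenvector
    obtain ⟨b, hb⟩ := exists_basis_sum_inl_eq (Module.finrank_fin_fun ℂ) hv.2
    set M := LinearMap.toMatrix b b (Matrix.toLin' A) with hM
    have hcol : ∀ i, M i (Sum.inl ()) = if i = Sum.inl () then μ 0 else 0 := by
      intro i
      rw [hM, LinearMap.toMatrix_apply, hb, hv.apply_eq_smul, map_smul, ← hb, b.repr_self]
      simp [Finsupp.single_apply, eq_comm]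
    have hMb : M = Matrix.fromBlocks (Matrix.diagonal fun _ ↦ μ 0) M.toBlocks₁₂ 0 M.toBlocks₂₂ := by
      conv_lhs => rw [← Matrix.fromBlocks_toBlocks M]
      congr 1
      · ext ⟨⟩ ⟨⟩
        simp [Matrix.toBlocks₁₁, hcol]
      · ext i ⟨⟩
        simp [Matrix.toBlocks₂₁, hcol]
    have hA' : M.toBlocks₂₂.charpoly = ∏ i : Fin n, (X - C (μ i.succ)) := by
      have h1 : M.charpoly = A.charpoly := by
        rw [hM, LinearMap.charpoly_toMatrix, Matrix.charpoly_toLin']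
      rw [hMb, Matrix.charpoly_fromBlocks_zero₂₁, h, Fin.prod_univ_succ, Matrix.charpoly_diagonal,
        Fintype.prod_unique] at h1
      exact mul_left_cancel₀ (X_sub_C_ne_zero _) h1
    obtain ⟨D, hD⟩ := ih _ _ (fun i ↦ c i.succ) hA'
    -- In a basis starting with an eigenvector the matrix is block upper triangular; a block
    -- diagonal direction keeps it so, whatever the corner block is.
    set D' : Matrix (Unit ⊕ Fin n) (Unit ⊕ Fin n) ℂ :=
      Matrix.fromBlocks (Matrix.diagonal fun _ ↦ c 0) 0 0 D with hD'
    refine ⟨LinearMap.toMatrix' (Matrix.toLin b b D'), fun t ↦ ?_⟩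
    have h2 : Matrix.toLin' (A + t • LinearMap.toMatrix' (Matrix.toLin b b D')) =
        Matrix.toLin b b (M + t • D') := by
      rw [map_add, map_smul, Matrix.toLin'_toMatrix', map_add, map_smul, hM, Matrix.toLin_toMatrix]
    rw [← Matrix.charpoly_toLin', h2, Matrix.charpoly_toLin, hMb, hD', Matrix.fromBlocks_smul,
      Matrix.fromBlocks_add, smul_zero, smul_zero, add_zero, add_zero,
      Matrix.charpoly_fromBlocks_zero₂₁, hD, Fin.prod_univ_succ, ← Matrix.diagonal_smul, Matrix.diagonal_add, Matrix.charpoly_diagonal,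
      Fintype.prod_unique]
    simp

variable {V : Type*} [AddCommGroup V] [Module ℂ V] [FiniteDimensional ℂ V]
  {ι : Type*} [Fintype ι]

lemma card_eq_finrank_of_charpoly_eq_prod {T : End ℂ V} {μ : ι → ℂ}
    (h : T.charpoly = ∏ i, (X - C (μ i))) : Fintype.card ι = finrank ℂ V := by
  rw [← LinearMap.charpoly_natDegree T, h, natDegree_finsetProd_X_sub_C_eq_card]
  rfl

lemma Module.End.exists_charpoly_add_smul (T : End ℂ V) (μ c : ι → ℂ)
    (h : T.charpoly = ∏ i, (X - C (μ i))) :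
    ∃ D : End ℂ V, ∀ t : ℂ, (T + t • D).charpoly = ∏ i, (X - C (μ i + t * c i)) := by
  let b := finBasisOfFinrankEq ℂ V (card_eq_finrank_of_charpoly_eq_prod h).symm
  let e := Fintype.equivFin ι
  obtain ⟨D, hD⟩ := (LinearMap.toMatrix b b T).exists_charpoly_add_smul (μ ∘ e.symm) (c ∘ e.symm)
    (by rw [LinearMap.charpoly_toMatrix, h, ← e.symm.prod_comp]; rfl)
  refine ⟨Matrix.toLin b b D, fun t ↦ ?_⟩
  rw [← LinearMap.charpoly_toMatrix _ b, map_add, map_smul, LinearMap.toMatrix_toLin, hD,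
    ← e.symm.prod_comp]
  rfl

lemma Module.End.exists_basis_apply_eq_smul {T : End ℂ V} {μ : ι → ℂ}
    (hμ : Function.Injective μ) (h : T.charpoly = ∏ i, (X - C (μ i))) :
    ∃ b : Basis ι ℂ V, ∀ i, T (b i) = μ i • b i := by
  have hev : ∀ i, ∃ v, T.HasEigenvector (μ i) v := fun i ↦ by
    apply HasEigenvalue.exists_hasEigenvector
    rw [hasEigenvalue_iff_isRoot_charpoly, h, IsRoot, eval_prod]
    exact Finset.prod_eq_zero (Finset.mem_univ i) (by simp)
  choose v hv using hev
  have hli := eigenvectors_linearIndependent' T μ hμ v hv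
  let b := basisOfLinearIndependentOfCardEqFinrank' v hli (card_eq_finrank_of_charpoly_eq_prod h)
  refine ⟨b, fun i ↦ ?_⟩
  simpa [b] using (hv i).apply_eq_smul

-- With `e i`, `f i` the eigenvectors for `l i`, `-l i`, take `M : f i ↦ l i • e i` and `N : e i ↦ f
-- i`, both zero on the other basis vectors.
omit [FiniteDimensional ℂ V] in
lemma exists_squareZero_commutator_of_basis {m r : ℕ} {T : End ℂ V} {l : Fin m → ℂ}
    (b : Basis ((Fin m ⊕ Fin m) ⊕ Fin r) ℂ V)
    (hb : ∀ i, T (b i) = Sum.elim (Sum.elim l (-l)) 0 i • b i) :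
    ∃ M N : End ℂ V, M ^ 2 = 0 ∧ N ^ 2 = 0 ∧ T = M * N - N * M := by
  refine ⟨b.constr ℂ (Sum.elim (Sum.elim 0 fun i ↦ l i • b (.inl (.inl i))) 0),
    b.constr ℂ (Sum.elim (Sum.elim (fun i ↦ b (.inl (.inr i))) 0) 0), ?_, ?_, ?_⟩ <;>
  · apply b.ext
    rintro ((i | i) | i) <;> simp [sq, hb]

/-- Pairs `a, -a` are stripped off one at a time. When none is left only zeros remain, and two zeros
would again be a pair. -/
lemma Multiset.exists_add_map_neg_add_replicate (s : Multiset ℂ) (hs : s.map Neg.neg = s) :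
    ∃ (l : Multiset ℂ) (r : ℕ), r ≤ 1 ∧ s = l + l.map Neg.neg + Multiset.replicate r 0 := by
  induction hk : Multiset.card s using Nat.strong_induction_on generalizing s with
  | _ k ih =>
    by_cases hp : ∃ (a : ℂ) (s' : Multiset ℂ), s = a ::ₘ -a ::ₘ s'
    · obtain ⟨a, s', rfl⟩ := hp
      have hs' : s'.map Neg.neg = s' := by
        rw [Multiset.map_cons, Multiset.map_cons, neg_neg, Multiset.cons_swap] at hs
        exact (Multiset.cons_inj_right _).1 ((Multiset.cons_inj_right _).1 hs)
      obtain ⟨l, r, hr, h⟩ := ih _ (by rw [← hk]; simp) s' hs' rfl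
      refine ⟨a ::ₘ l, r, hr, ?_⟩
      conv_lhs => rw [h]
      rw [Multiset.map_cons, Multiset.cons_add, Multiset.cons_add, Multiset.add_cons,
        Multiset.cons_add]
    · have hall : ∀ a ∈ s, a = 0 := by
        intro a ha
        by_contra h0
        obtain ⟨s', rfl⟩ := Multiset.exists_cons_of_mem ha
        have hna : -a ∈ a ::ₘ s' := by
          rw [← hs]
          exact Multiset.mem_map_of_mem _ ha
        rcases Multiset.mem_cons.1 hna with h | h
        · exact h0 (neg_eq_self.1 h)
        · obtain ⟨s'', rfl⟩ := Multiset.exists_cons_of_mem h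
          exact hp ⟨a, s'', rfl⟩
      have hrep := Multiset.eq_replicate_card.2 hall
      refine ⟨0, Multiset.card s, ?_, by simpa using hrep⟩
      by_contra! h2
      obtain ⟨j, hj⟩ := Nat.exists_eq_add_of_le' h2
      refine hp ⟨0, Multiset.replicate j 0, ?_⟩
      rw [hrep, hj, neg_zero, ← Multiset.replicate_succ, ← Multiset.replicate_succ]

/-- Indices with equal `μ` are separated by `c` for every `t ≠ 0`; those with distinct `μ` stay
separated for small `t`. -/
lemma eventually_injective_add_mul (μ : ι → ℂ) {c : ι → ℂ} (hc : Function.Injective c) :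
    ∀ᶠ t in nhdsWithin (0 : ℂ) {0}ᶜ, Function.Injective fun i ↦ μ i + t * c i := by
  have h : ∀ᶠ t in nhdsWithin (0 : ℂ) {0}ᶜ, ∀ i j, i ≠ j → μ i + t * c i ≠ μ j + t * c j := by
    rw [Filter.eventually_all]
    intro i
    rw [Filter.eventually_all]
    intro j
    by_cases hij : i = j
    · simp [hij]
    have hcc : c i - c j ≠ 0 := sub_ne_zero.2 (hc.ne hij)
    by_cases hμ : μ i = μ j
    · filter_upwards [self_mem_nhdsWithin] with t ht _ heq
      rw [hμ, add_right_inj] at heq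
      exact hij (hc (mul_left_cancel₀ ht heq))
    · have hcont : Continuous fun t : ℂ ↦ μ i + t * c i - (μ j + t * c j) := by fun_prop
      have := hcont.continuousAt.eventually_ne (x := 0) (y := 0) (by simpa [sub_eq_zero] using hμ)
      filter_upwards [nhdsWithin_le_nhds this] with t ht _
      exact sub_ne_zero.1 ht
  filter_upwards [h] with t ht i j hij
  by_contra hne
  exact ht i j hne hij

lemma charpoly_eq_prod_of_roots_map_neg {T : End ℂ V}
    (hT : T.charpoly.roots.map Neg.neg = T.charpoly.roots) :
    ∃ (m r : ℕ) (l : Fin m → ℂ), r ≤ 1 ∧ T.charpoly =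
      ∏ i : (Fin m ⊕ Fin m) ⊕ Fin r, (X - C (Sum.elim (Sum.elim l (-l)) 0 i)) := by
  obtain ⟨s, r, hr, hs⟩ := Multiset.exists_add_map_neg_add_replicate _ hT
  obtain ⟨L, rfl⟩ : ∃ L : List ℂ, s = L := ⟨s.toList, s.coe_toList.symm⟩
  refine ⟨L.length, r, L.get, hr, ?_⟩
  rw [(IsAlgClosed.splits _).eq_prod_roots_of_monic (LinearMap.charpoly_monic T), hs]
  simp only [Multiset.map_add, Multiset.prod_add, Fintype.prod_sum_type,
    Multiset.map_coe, Multiset.prod_coe, Multiset.map_replicate, Multiset.prod_replicate,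
    Sum.elim_inl, Sum.elim_inr, List.map_map, Pi.neg_apply, Pi.zero_apply, Finset.prod_const,
    Finset.card_univ, Fintype.card_fin]
  rw [← Fin.prod_univ_fun_getElem L, ← Fin.prod_univ_fun_getElem L, map_zero, sub_zero]
  rfl

end Density

/-! ### Symmetric characteristic polynomials and the norm closure -/

section Balanced

open Polynomial Module Metric

variable {H : Type*} [NormedAddCommGroup H] [InnerProductSpace ℂ H] [FiniteDimensional ℂ H]

lemma algMultiplicity_neg (T : H →L[ℂ] H) (α : ℂ) :
    algMultiplicity (-T) α = algMultiplicity T (-α) := by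
  suffices hEq : Module.End.maxGenEigenspace ((-T : H →L[ℂ] H) : End ℂ H) α =
      Module.End.maxGenEigenspace (T : End ℂ H) (-α) by
    rw [algMultiplicity, algMultiplicity, ← LinearMap.finrank_maxGenEigenspace_eq,
      ← LinearMap.finrank_maxGenEigenspace_eq, hEq]
  ext v
  simp only [Module.End.mem_maxGenEigenspace]
  refine exists_congr fun k ↦ ?_
  -- The two shifted operators differ by a sign, so their powers have the same kernels.
  have h : ((-T : H →L[ℂ] H) : End ℂ H) - α • 1 = -((T : End ℂ H) - (-α) • 1) := by
    ext v
    simp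
    abel
  rw [h, neg_pow]
  rcases neg_one_pow_eq_or (End ℂ H) k with h | h <;> simp [h]

lemma charpoly_eq_charpoly_neg_iff (T : H →L[ℂ] H) :
    (T : End ℂ H).charpoly = ((-T : H →L[ℂ] H) : End ℂ H).charpoly ↔
      ∀ α, algMultiplicity T α = algMultiplicity T (-α) := by
  constructor
  · intro h α
    rw [← algMultiplicity_neg, algMultiplicity, algMultiplicity, h]
  · intro h
    rw [(IsAlgClosed.splits (T : End ℂ H).charpoly).eq_prod_roots_of_monic
      (LinearMap.charpoly_monic _),
      (IsAlgClosed.splits ((-T : H →L[ℂ] H) : End ℂ H).charpoly).eq_prod_roots_of_monic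
      (LinearMap.charpoly_monic _)]
    congr 2
    ext α
    rw [count_roots, count_roots]
    exact (h α).trans (algMultiplicity_neg T α).symm

lemma roots_charpoly_map_neg {T : H →L[ℂ] H}
    (h : ∀ α, algMultiplicity T α = algMultiplicity T (-α)) :
    (T : End ℂ H).charpoly.roots.map Neg.neg = (T : End ℂ H).charpoly.roots := by
  ext α
  have := Multiset.count_map_eq_count' Neg.neg (T : End ℂ H).charpoly.roots neg_injective (-α)
  rw [neg_neg] at this
  rw [this, count_roots, count_roots]
  exact (h α).symm

/-- Polynomials over `ℂ` agree when all their values do, and each value is a determinant, continuous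
in `T`. -/
lemma isClosed_charpoly_eq_charpoly_neg :
    IsClosed {T : H →L[ℂ] H |
      (T : End ℂ H).charpoly = ((-T : H →L[ℂ] H) : End ℂ H).charpoly} := by
  have h : {T : H →L[ℂ] H |
      (T : End ℂ H).charpoly = ((-T : H →L[ℂ] H) : End ℂ H).charpoly} =
      ⋂ z : ℂ, {T : H →L[ℂ] H | (algebraMap ℂ (H →L[ℂ] H) z - T).det =
        (algebraMap ℂ (H →L[ℂ] H) z - -T).det} := by
    ext T
    rw [Set.mem_iInter, Set.mem_ofPred_eq]
    have hdet : ∀ (S : H →L[ℂ] H) (z : ℂ),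
        (algebraMap ℂ (H →L[ℂ] H) z - S).det = (S : End ℂ H).charpoly.eval z := fun S z ↦ by
      rw [LinearMap.eval_charpoly]
      rfl
    simp only [Set.mem_ofPred_eq, hdet]
    exact ⟨fun h z ↦ by rw [h], Polynomial.funext⟩
  rw [h]
  refine isClosed_iInter fun z ↦ isClosed_eq ?_ ?_
  · exact ContinuousLinearMap.continuous_det.comp (continuous_const.sub continuous_id)
  · exact ContinuousLinearMap.continuous_det.comp (continuous_const.sub continuous_neg)

lemma LinearMap.charpoly_mul_comm {V : Type*} [AddCommGroup V] [Module ℂ V]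
    [FiniteDimensional ℂ V] (A B : End ℂ V) : (A * B).charpoly = (B * A).charpoly := by
  let b := finBasis ℂ V
  rw [← LinearMap.charpoly_toMatrix _ b, ← LinearMap.charpoly_toMatrix _ b,
    LinearMap.toMatrix_mul, LinearMap.toMatrix_mul, Matrix.charpoly_mul_comm]

lemma charpoly_eq_charpoly_neg_of_mem_operatorCommutators {T : H →L[ℂ] H}
    (hT : T ∈ operatorCommutators (squareZeroOps H)) :
    (T : End ℂ H).charpoly = ((-T : H →L[ℂ] H) : End ℂ H).charpoly := by
  obtain ⟨M, hM, N, hN, rfl⟩ := hT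
  have hM' : M * M = 0 := by rw [← sq]; exact hM
  have hN' : N * N = 0 := by rw [← sq]; exact hN
  have h1 : M * N - N * M = (M - N) * (M + N) := by
    rw [sub_mul, mul_add, mul_add, hM', hN']; abel
  have h2 : -(M * N - N * M) = (M + N) * (M - N) := by
    rw [add_mul, mul_sub, mul_sub, hM', hN']; abel
  rw [h2, h1]
  exact LinearMap.charpoly_mul_comm ((M - N : H →L[ℂ] H) : End ℂ H) ((M + N : H →L[ℂ] H) : End ℂ H)

lemma mem_operatorCommutators_of_charpoly_eq_prod {T : H →L[ℂ] H} {m r : ℕ} {l : Fin m → ℂ}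
    (hinj : Function.Injective (Sum.elim (Sum.elim l (-l)) (0 : Fin r → ℂ)))
    (h : (T : End ℂ H).charpoly =
      ∏ i : (Fin m ⊕ Fin m) ⊕ Fin r, (X - C (Sum.elim (Sum.elim l (-l)) 0 i))) :
    T ∈ operatorCommutators (squareZeroOps H) := by
  obtain ⟨b, hb⟩ := Module.End.exists_basis_apply_eq_smul hinj h
  obtain ⟨M, N, hM, hN, hT⟩ := exists_squareZero_commutator_of_basis b hb
  let e := Module.End.toContinuousLinearMap (𝕜 := ℂ) H
  refine ⟨e M, ?_, e N, ?_, ?_⟩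
  · rw [squareZeroOps, Set.mem_ofPred_eq, ← map_pow, hM, map_zero]
  · rw [squareZeroOps, Set.mem_ofPred_eq, ← map_pow, hN, map_zero]
  · rw [← map_mul, ← map_mul, ← map_sub, ← hT]
    rfl

lemma mem_closure_operatorCommutators {T : H →L[ℂ] H}
    (h : ∀ α, algMultiplicity T α = algMultiplicity T (-α)) :
    T ∈ closure (operatorCommutators (squareZeroOps H)) := by
  obtain ⟨m, r, l, hr, hT⟩ := charpoly_eq_prod_of_roots_map_neg (roots_charpoly_map_neg h)
  -- The directions are `1, …, m`, their negatives, and `0`: pairwise distinct because `r ≤ 1`, and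
  -- odd like the eigenvalues, so the pairing survives.
  let c₀ : Fin m → ℂ := fun i ↦ (i : ℂ) + 1
  let c : (Fin m ⊕ Fin m) ⊕ Fin r → ℂ := Sum.elim (Sum.elim c₀ (-c₀)) 0
  have hpos : ∀ i j : Fin m, c₀ i + c₀ j ≠ 0 := fun i j ↦ by
    have : ((i + 1 + (j + 1) : ℕ) : ℂ) ≠ 0 := Nat.cast_ne_zero.2 (by omega)
    simpa [c₀] using this
  have hpos' : ∀ i : Fin m, c₀ i ≠ 0 := fun i hi ↦ hpos i i (by rw [hi, add_zero])
  have hc₀ : Function.Injective c₀ := fun i j hij ↦ by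
    simpa [c₀, Fin.val_inj] using hij
  have hc : Function.Injective c := by
    have : Subsingleton (Fin r) := Fin.subsingleton_iff_le_one.2 hr
    refine ((hc₀.sumElim (neg_injective.comp hc₀) fun i j hij ↦ ?_)).sumElim
      (Function.injective_of_subsingleton _) ?_
    · exact hpos i j (by rw [hij]; simp)
    · rintro (i | i) j hij
      · exact hpos' i hij
      · exact hpos' i (neg_eq_zero.1 hij)
  obtain ⟨D, hD⟩ := Module.End.exists_charpoly_add_smul _ _ c hT
  let D' : H →L[ℂ] H := LinearMap.toContinuousLinearMap D
  have hlim : Filter.Tendsto (fun t : ℂ ↦ T + t • D') (nhdsWithin 0 {0}ᶜ) (nhds T) := by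
    have hcont : Continuous fun t : ℂ ↦ T + t • D' := by fun_prop
    simpa using (hcont.tendsto 0).mono_left nhdsWithin_le_nhds
  refine mem_closure_of_tendsto hlim ?_
  filter_upwards [eventually_injective_add_mul _ hc] with t ht
  have heq : (fun i ↦ Sum.elim (Sum.elim l (-l)) 0 i + t * c i) =
      Sum.elim (Sum.elim (fun i ↦ l i + t * c₀ i) (-fun i ↦ l i + t * c₀ i)) 0 := by
    ext ((i | i) | i) <;> simp [c]
    ring
  rw [heq] at ht
  refine mem_operatorCommutators_of_charpoly_eq_prod ht ?_
  rw [← heq]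
  exact hD t

theorem closure_operatorCommutators_squareZeroOps :
    closure (operatorCommutators (squareZeroOps H)) =
      {T : H →L[ℂ] H | ∀ α, algMultiplicity T α = algMultiplicity T (-α)} := by
  apply Set.Subset.antisymm
  · simp only [← charpoly_eq_charpoly_neg_iff]
    exact closure_minimal (fun T ↦ charpoly_eq_charpoly_neg_of_mem_operatorCommutators)
      isClosed_charpoly_eq_charpoly_neg
  · exact fun T ↦ mem_closure_operatorCommutators

/-! ### Balancedness in finite dimension -/

lemma isSemiFredholm_of_finiteDimensional (A : H →L[ℂ] H) : IsSemiFredholm A := by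
  have : ProperSpace H := FiniteDimensional.proper ℂ H
  exact .inl ⟨0, isCompactOperator_of_locallyCompactSpace_dom _⟩

variable [CompleteSpace H]

lemma algMultiplicity_symm_iff {T : H →L[ℂ] H} :
    (∀ α, algMultiplicity T α = algMultiplicity T (-α)) ↔
      ∀ α ∈ spectrum ℂ T, -α ∈ spectrum ℂ T ∧ algMultiplicity T α = algMultiplicity T (-α) := by
  constructor
  · intro h α hα
    refine ⟨?_, h α⟩
    rw [← algMultiplicity_pos_iff, ← h α]
    exact algMultiplicity_pos_iff.2 hα
  · intro h α
    by_cases hα : α ∈ spectrum ℂ T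
    · exact (h α hα).2
    · have hα' : -α ∉ spectrum ℂ T := fun h' ↦ hα (by simpa using (h _ h').1)
      rw [← algMultiplicity_pos_iff] at hα hα'
      omega

/-- Rank-nullity, since the kernel of the adjoint is the orthogonal complement of the range. -/
lemma fredholmIndex_eq_zero (A : H →L[ℂ] H) : fredholmIndex A = 0 := by
  have h1 : ((ContinuousLinearMap.adjoint A : H →L[ℂ] H) : H →ₗ[ℂ] H).ker =
      ((A : H →ₗ[ℂ] H).range)ᗮ := (A.orthogonal_range).symm
  have h2 := Submodule.finrank_add_finrank_orthogonal (A : H →ₗ[ℂ] H).range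
  have h3 := LinearMap.finrank_range_add_finrank_ker (A : H →ₗ[ℂ] H)
  rw [fredholmIndex, h1]
  omega

lemma IsBalanced.algMultiplicity_eq {T : H →L[ℂ] H} (hT : IsBalanced T) (α : ℂ)
    (hα : α ∈ spectrum ℂ T) :
    -α ∈ spectrum ℂ T ∧ algMultiplicity T α = algMultiplicity T (-α) := by
  have hsymm : ∀ β ∈ spectrum ℂ T, -β ∈ spectrum ℂ T := by
    intro β hβ
    rw [hT.spectrum_eq, ← spectrum.neg_eq]
    simpa using hβ
  refine ⟨hsymm α hα, ?_⟩
  obtain ⟨r, hr, -, hdis⟩ :=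
    exists_disjoint_closedBalls (finite_spectrum_clm T) isOpen_univ (Set.subset_univ _)
  have hball : ∀ β ∈ spectrum ℂ T, β ∈ closedBall α r → β = α := by
    intro β hβ hβα
    by_contra hne
    exact Set.disjoint_left.1 (hdis β hβ α hα hne) (mem_closedBall_self hr.le) hβα
  -- The closed disc meets the spectrum only at `α`, so the open disc and the complement of the
  -- closed one cover the spectrum; the reflected disc isolates `-α`.
  obtain ⟨E, F, hE, hF, hEF⟩ := hT.dim_eq (ball α r) (closedBall α r)ᶜ isOpen_ball
    isClosed_closedBall.isOpen_compl
    (Set.disjoint_left.2 fun z hz hz' ↦ hz' (ball_subset_closedBall hz)) (by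
      intro β hβ
      by_cases h : β ∈ closedBall α r
      · rw [hball β hβ h]
        exact .inl (mem_ball_self hr)
      · exact .inr h)
  rw [hE.finrank_range {α}, hF.finrank_range {-α}] at hEF
  · simpa using hEF
  · ext β
    simp only [Finset.coe_singleton, Set.mem_singleton_iff, Set.mem_inter_iff, Set.mem_neg]
    constructor
    · rintro rfl
      exact ⟨hsymm α hα, by simpa using hr⟩
    · rintro ⟨h1, h2⟩
      rw [← hball _ (hsymm β h1) (ball_subset_closedBall h2), neg_neg]
  · ext β
    simp only [Finset.coe_singleton, Set.mem_singleton_iff, Set.mem_inter_iff]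
    constructor
    · rintro rfl
      exact ⟨hα, mem_ball_self hr⟩
    · rintro ⟨h1, h2⟩
      exact hball β h1 (ball_subset_closedBall h2)

lemma isBalanced_of_algMultiplicity_eq {T : H →L[ℂ] H}
    (h : ∀ α, algMultiplicity T α = algMultiplicity T (-α)) : IsBalanced T := by
  have hsymm : ∀ α ∈ spectrum ℂ T, -α ∈ spectrum ℂ T := fun α hα ↦
    (algMultiplicity_symm_iff.1 h α hα).1
  refine ⟨?_, ?_, fun α ↦ ⟨⟨fun _ ↦ isSemiFredholm_of_finiteDimensional _,
    fun _ ↦ isSemiFredholm_of_finiteDimensional _⟩, fun _ ↦ by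
      rw [fredholmIndex_eq_zero, fredholmIndex_eq_zero]⟩⟩
  · rw [← spectrum.neg_eq]
    ext α
    exact ⟨hsymm α, fun hα ↦ by simpa using hsymm _ hα⟩
  · intro Ω₁ Ω₂ hΩ₁ _ _ _
    obtain ⟨E, hE⟩ := exists_isRieszIdempotent T hΩ₁
    obtain ⟨F, hF⟩ := exists_isRieszIdempotent T hΩ₁.neg
    refine ⟨E, F, hE, hF, ?_⟩
    have hfin : (spectrum ℂ T ∩ Ω₁).Finite := (finite_spectrum_clm T).inter_of_left _
    -- Negation carries the spectrum in `Ω₁` bijectively onto the spectrum in `-Ω₁`, matching the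
    -- two sums term by term.
    rw [hE.finrank_range hfin.toFinset hfin.coe_toFinset,
      hF.finrank_range (hfin.toFinset.map ⟨Neg.neg, neg_injective⟩), Finset.sum_map]
    · exact Finset.sum_congr rfl fun α _ ↦ h α
    · ext β
      simp only [Finset.coe_map, Set.Finite.coe_toFinset, Function.Embedding.coeFn_mk,
        Set.mem_image, Set.mem_inter_iff, Set.mem_neg]
      constructor
      · rintro ⟨α, ⟨h1, h2⟩, rfl⟩
        exact ⟨hsymm α h1, by simpa using h2⟩
      · rintro ⟨h1, h2⟩
        exact ⟨-β, ⟨hsymm β h1, h2⟩, neg_neg β⟩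

end Balanced

theorem theorem4p03 {H : Type*} [NormedAddCommGroup H] [InnerProductSpace ℂ H] [CompleteSpace H]
    [FiniteDimensional ℂ H] :
    closure (operatorCommutators (squareZeroOps H)) = {T : H →L[ℂ] H | IsBalanced T} ∧
    closure (operatorCommutators (squareZeroOps H)) =
      {T : H →L[ℂ] H | ∀ α ∈ spectrum ℂ T,
        -α ∈ spectrum ℂ T ∧ algMultiplicity T α = algMultiplicity T (-α)} := by
  rw [closure_operatorCommutators_squareZeroOps]
  constructor
  · ext T
    exact ⟨isBalanced_of_algMultiplicity_eq,
      fun hT ↦ algMultiplicity_symm_iff.2 hT.algMultiplicity_eq⟩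
  · ext T
    exact algMultiplicity_symm_iff
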